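/- Let $L$ be an odd positive integer, with sites $0,\dots,L-1$ and site indices taken modulo $L$. Let $CU_{\mathrm{Sym}}(L)$ be the compact group of unitary $u\in\mathbb{C}^{L\times L}$ with $u_{i+k,j+k}=u_{i,j}$ and $u_{i,j}=u_{j,i}$ for all $i,j,k$. Let $a_0,\dots,a_{L-1}$ be the fermionic annihilation operators on the Fock space of $L$ modes, which has the orthonormal basis $|n\rangle=(a_0^\dagger)^{n_0}\cdots(a_{L-1}^\dagger)^{n_{L-1}}|0\rangle$, $n\in\{0,1\}^L$. Let $U$ be a random unitary on Fock space acting on the modes by $U a_i U^\dagger=\sum_j u_{i,j}a_j$ for all $i$, where the random matrix $u$ is distributed according to the normalized Haar measure on $CU_{\mathrm{Sym}}(L)$. Let $$\mathcal{M}(X)=\sum_{n\in\{0,1\}^L}\mathbb{E}_U\,\langle n|UXU^\dagger|n\rangle\;U^\dagger|n\rangle\langle n|U$$ be the associated measurement channel. Then there is exactly one tensor $M^{(2)}$ of complex numbers such that $$\mathcal{M}(a_i^\dagger a_j)=\sum_{l,m=0}^{L-1}M^{(2)}_{ij,lm}\,a_l^\dagger a_m\qquad\text{for all } i,j,$$ and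 it is given by $$M^{(2)}_{ij,lm}=\frac1L\left(\delta_{i,j}\delta_{l,m}+\delta_{i,l}\delta_{j,m}-\frac1L\,\delta_{i-j,l-m}\right),$$ where $\delta_{i-j,l-m}$ is $1$ if $i-j\equiv l-m \pmod L$ and $0$ otherwise. -/

import Mathlib

open MeasureTheory
open scoped Matrix

noncomputable section

/-! ### Symmetric circulant unitaries on the mode space -/

/-- A matrix indexed by the sites `0, …, L - 1` is circulant if it is invariant under simultaneous
translation of both indices; addition on `Fin L` is addition modulo `L`. -/
def IsCirculant {L : ℕ} (A : Matrix (Fin L) (Fin L) ℂ) : Prop :=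
  ∀ i j k : Fin L, A (i + k) (j + k) = A i j

lemma IsCirculant.mul {L : ℕ} {A B : Matrix (Fin L) (Fin L) ℂ}
    (hA : IsCirculant A) (hB : IsCirculant B) : IsCirculant (A * B) := by
  cases L with
  | zero => exact fun i => i.elim0
  | succ n =>
    intro i j k
    rw [Matrix.mul_apply, Matrix.mul_apply, ← Equiv.sum_comp (Equiv.addRight k)]
    exact Finset.sum_congr rfl fun x _ => by
      rw [Equiv.coe_addRight, hA i x k, hB x j k]

lemma IsCirculant.mul_comm {L : ℕ} {A B : Matrix (Fin L) (Fin L) ℂ}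
    (hA : IsCirculant A) (hB : IsCirculant B) : A * B = B * A := by
  cases L with
  | zero => exact Subsingleton.elim _ _
  | succ n =>
    have key : ∀ {C : Matrix (Fin (n + 1)) (Fin (n + 1)) ℂ}, IsCirculant C →
        C = Matrix.circulant fun i => C i 0 := by
      intro C hC
      ext i j
      have h := hC (i - j) 0 j
      rw [sub_add_cancel, zero_add] at h
      rw [h, Matrix.circulant_apply]
    rw [key hA, key hB, Matrix.circulant_mul_comm]

/-- The group `CU_Sym(L)` of symmetric circulant unitary `L × L` matrices. -/
def CUSym (L : ℕ) : Subgroup (Matrix.unitaryGroup (Fin L) ℂ) where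
  carrier := {u | IsCirculant (u : Matrix (Fin L) (Fin L) ℂ) ∧
    ∀ i j : Fin L, (u : Matrix (Fin L) (Fin L) ℂ) i j = (u : Matrix (Fin L) (Fin L) ℂ) j i}
  one_mem' := by
    refine ⟨?_, fun i j => ?_⟩
    · cases L with
      | zero => exact fun i => i.elim0
      | succ n =>
        intro i j k
        simp [Matrix.one_apply]
    · simp [Matrix.one_apply, eq_comm]
  mul_mem' := by
    rintro u v ⟨hu, hu'⟩ ⟨hv, hv'⟩
    refine ⟨hu.mul hv, fun i j => ?_⟩
    have h : (u * v : Matrix (Fin L) (Fin L) ℂ) = v * u := hu.mul_comm hv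
    change (u * v : Matrix (Fin L) (Fin L) ℂ) i j = (u * v : Matrix (Fin L) (Fin L) ℂ) j i
    conv_rhs => rw [h]
    rw [Matrix.mul_apply, Matrix.mul_apply]
    exact Finset.sum_congr rfl fun x _ => by rw [hu' i x, hv' x j, _root_.mul_comm]
  inv_mem' := by
    rintro u ⟨hu, hu'⟩
    refine ⟨fun i j k => ?_, fun i j => ?_⟩
    · change star ((u : Matrix (Fin L) (Fin L) ℂ) (j + k) (i + k)) =
        star ((u : Matrix (Fin L) (Fin L) ℂ) j i)
      rw [hu]
    · change star ((u : Matrix (Fin L) (Fin L) ℂ) j i) =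
        star ((u : Matrix (Fin L) (Fin L) ℂ) i j)
      rw [hu']

/-- The Borel σ-algebra, for the topology inherited from the space of matrices. -/
instance (L : ℕ) : MeasurableSpace (CUSym L) := borel _

instance (L : ℕ) : BorelSpace (CUSym L) := ⟨rfl⟩

/-! ### Fermionic Fock space of `L` modes -/

/-- Operators on the Fock space of `L` fermionic modes, as matrices in the Fock basis. The
occupation vector `n ∈ {0,1}^L` is recorded as the set of occupied sites, and the basis vector
`|n⟩ = (a₀†)^{n₀} ⋯ (a_{L-1}†)^{n_{L-1}} |0⟩` is the one with index `n`. -/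
abbrev FockOp (L : ℕ) : Type := Matrix (Finset (Fin L)) (Finset (Fin L)) ℂ

/-- The annihilation operator `a_j`: it sends `|n⟩` to `(-1)^{n₀ + ⋯ + n_{j-1}} |n \ {j}⟩` if `j` is
occupied in `n`, and to `0` otherwise. -/
def annihilation {L : ℕ} (j : Fin L) : FockOp L :=
  Matrix.of fun m n =>
    if j ∈ n ∧ m = n.erase j then (-1) ^ (n.filter (fun k => k < j)).card else 0

/-- The creation operator `a_j†`. -/
def creation {L : ℕ} (j : Fin L) : FockOp L := (annihilation j)ᴴ

/-- The unitary `U` on Fock space acts on the modes through the matrix `u`: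
`U a_i U† = ∑_j u_{ij} a_j` for all `i`. -/
def HasModeUnitary {L : ℕ} (U : Matrix.unitaryGroup (Finset (Fin L)) ℂ)
    (u : Matrix (Fin L) (Fin L) ℂ) : Prop :=
  ∀ i : Fin L, (U : FockOp L) * annihilation i * (U : FockOp L)ᴴ =
    ∑ j : Fin L, u i j • annihilation j

/-! ### The measurement channel -/

/-- The rank one projection `|n⟩⟨n|` onto a Fock basis vector. -/
def fockProj {L : ℕ} (n : Finset (Fin L)) : FockOp L := Matrix.single n n 1

/-- The measurement channel
`X ↦ ∑_n 𝔼_U ⟨n| U X U† |n⟩ U† |n⟩⟨n| U` of a random unitary `U` on Fock space; the expectation of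
the operator-valued random variable is taken entry by entry. -/
def measurementChannel {L : ℕ} {Ω : Type*} [MeasurableSpace Ω] (P : Measure Ω)
    (U : Ω → Matrix.unitaryGroup (Finset (Fin L)) ℂ) (X : FockOp L) : FockOp L :=
  ∑ n : Finset (Fin L), Matrix.of fun a b => ∫ ω,
    ((U ω : FockOp L) * X * (U ω : FockOp L)ᴴ) n n *
      ((U ω : FockOp L)ᴴ * fockProj n * (U ω : FockOp L)) a b ∂P

/-- `M` is the coefficient tensor of the measurement channel on the `2`-point operators:
`𝓜(a_i† a_j) = ∑_{l,m} M_{ij,lm} a_l† a_m` for all `i, j`. -/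
def IsTwoPointBlock {L : ℕ} {Ω : Type*} [MeasurableSpace Ω] (P : Measure Ω)
    (U : Ω → Matrix.unitaryGroup (Finset (Fin L)) ℂ)
    (M : Fin L → Fin L → Fin L → Fin L → ℂ) : Prop :=
  ∀ i j : Fin L, measurementChannel P U (creation i * annihilation j) =
    ∑ l : Fin L, ∑ m : Fin L, M i j l m • (creation l * annihilation m)

end

/-! Conjugating by $U$ turns $a_i^\dagger a_j$ into a quadratic form in the modes. Measuring in the
Fock basis keeps only its diagonal part, a combination of number operators. Conjugating back gives,
for every realization, the coefficient $\sum_k \bar u_{ik}u_{jk}u_{lk}\bar u_{mk}$ of $a_l^\dagger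
a_m$ (`HasModeUnitary.sum_twoPoint_diag_smul`). By linear independence of the $a_l^\dagger a_m$, the
tensor is the Haar average of this quantity.

The Fourier transform diagonalizes $u$; its eigenvalues $\lambda_p$ are phases with
$\lambda_{-p}=\lambda_p$, otherwise arbitrary (`exists_momentumEigenvalue_eq`). The sum over $k$
imposes $p+s=q+r$ on the products $\bar\lambda_p\lambda_q\lambda_r\bar\lambda_s$. Each product is a
character of the group, so it averages to $1$ if trivial and to $0$ otherwise. For odd $L$, where
$2$ is invertible, momentum conservation leaves only the pairings $q=p,\ r=s$ and $q=s,\ r=p$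
(`integral_eigenvalueProduct`). These give the two products of deltas; their overlap $p=q=r=s$,
counted twice, gives the correction $-\frac1L\delta_{i-j,l-m}$. -/

section Fock

variable {L : ℕ}

/-! ### Matrix elements of two-point operators in the Fock basis. -/

lemma annihilation_apply (j : Fin L) (m n : Finset (Fin L)) :
    annihilation j m n =
      if j ∈ n ∧ m = n.erase j then (-1 : ℂ) ^ (n.filter (fun k => k < j)).card else 0 := rfl

lemma creation_apply (j : Fin L) (m n : Finset (Fin L)) :
    creation j m n =
      if j ∈ m ∧ n = m.erase j then (-1 : ℂ) ^ (m.filter (fun k => k < j)).card else 0 := by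
  simp only [creation, Matrix.conjTranspose_apply, annihilation_apply]
  split_ifs <;> simp

lemma creation_mul_annihilation_apply (k l : Fin L) (m n : Finset (Fin L)) :
    (creation k * annihilation l) m n =
      if k ∈ m ∧ l ∈ n ∧ m.erase k = n.erase l then
        (-1 : ℂ) ^ (m.filter (fun x => x < k)).card * (-1) ^ (n.filter (fun x => x < l)).card
      else 0 := by
  rw [Matrix.mul_apply, Finset.sum_eq_single (m.erase k)]
  · rw [creation_apply, annihilation_apply]
    split_ifs <;> simp_all
  · intro b _ hb
    rw [creation_apply, if_neg (fun h => hb h.2), zero_mul]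
  · simp

lemma creation_mul_annihilation_self (k : Fin L) :
    creation k * annihilation k = Matrix.diagonal fun n : Finset (Fin L) =>
      if k ∈ n then (1 : ℂ) else 0 := by
  ext m n
  rw [creation_mul_annihilation_apply, Matrix.diagonal_apply]
  by_cases hmn : m = n
  · subst hmn
    by_cases hk : k ∈ m
    · simp [hk, ← mul_pow]
    · simp [hk]
  · rw [if_neg hmn, if_neg]
    rintro ⟨h1, h2, h3⟩
    exact hmn (by rw [← Finset.insert_erase h1, h3, Finset.insert_erase h2])

/-- Hopping between distinct sites changes the occupation, so only number operators survive on the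
diagonal. -/
lemma creation_mul_annihilation_apply_diag (k l : Fin L) (n : Finset (Fin L)) :
    (creation k * annihilation l) n n = if k = l then (if k ∈ n then 1 else 0) else 0 := by
  by_cases hkl : k = l
  · subst hkl
    rw [creation_mul_annihilation_self, Matrix.diagonal_apply_eq, if_pos rfl]
  · rw [if_neg hkl, creation_mul_annihilation_apply, if_neg]
    rintro ⟨h1, h2, h3⟩
    have : k ∈ n.erase l := Finset.mem_erase.2 ⟨hkl, h1⟩
    rw [← h3] at this
    simp at this

lemma creation_mul_annihilation_apply_singleton (k l i j : Fin L) :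
    (creation k * annihilation l) {i} {j} = if k = i ∧ l = j then 1 else 0 := by
  rw [creation_mul_annihilation_apply]
  by_cases h : k = i ∧ l = j
  · obtain ⟨rfl, rfl⟩ := h
    simp [Finset.filter_singleton]
  · rw [if_neg h, if_neg]
    simpa using fun h1 h2 => (h ⟨h1, h2⟩).elim

/-- The operators `a_l† a_m` are linearly independent. -/
lemma twoPoint_coeff_ext {c d : Fin L → Fin L → ℂ}
    (h : ∑ l, ∑ m, c l m • (creation l * annihilation m) =
      ∑ l, ∑ m, d l m • (creation l * annihilation m)) (l m : Fin L) : c l m = d l m := by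
  -- The one-particle sector already separates the coefficients.
  have key : ∀ e : Fin L → Fin L → ℂ,
      (∑ l, ∑ m, e l m • (creation l * annihilation m) : FockOp L) {l} {m} = e l m := by
    intro e
    simp only [Matrix.sum_apply, Matrix.smul_apply, creation_mul_annihilation_apply_singleton,
      smul_eq_mul, ite_and, mul_ite, mul_one, mul_zero]
    rw [Finset.sum_eq_single l (fun b _ hb => by simp [hb]) (by simp)]
    simp
  rw [← key c, ← key d, h]

/-! ### Conjugation by a mode unitary. -/

section ModeUnitary

variable {U : Matrix.unitaryGroup (Finset (Fin L)) ℂ} {u : Matrix (Fin L) (Fin L) ℂ}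

lemma conjTranspose_mul_self_of_unitary {ι : Type*} [Fintype ι] [DecidableEq ι]
    (U : Matrix.unitaryGroup ι ℂ) : (U : Matrix ι ι ℂ)ᴴ * (U : Matrix ι ι ℂ) = 1 :=
  Matrix.mem_unitaryGroup_iff'.1 U.2

lemma mul_conjTranspose_self_of_unitary {ι : Type*} [Fintype ι] [DecidableEq ι]
    (U : Matrix.unitaryGroup ι ℂ) : (U : Matrix ι ι ℂ) * (U : Matrix ι ι ℂ)ᴴ = 1 :=
  Matrix.mem_unitaryGroup_iff.1 U.2

lemma conj_mul_conj_of_unitary {ι : Type*} [Fintype ι] [DecidableEq ι]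
    (U : Matrix.unitaryGroup ι ℂ) (A B : Matrix ι ι ℂ) :
    (U : Matrix ι ι ℂ) * (A * B) * (U : Matrix ι ι ℂ)ᴴ =
      ((U : Matrix ι ι ℂ) * A * (U : Matrix ι ι ℂ)ᴴ) *
        ((U : Matrix ι ι ℂ) * B * (U : Matrix ι ι ℂ)ᴴ) := by
  have h := conjTranspose_mul_self_of_unitary U
  calc (U : Matrix ι ι ℂ) * (A * B) * (U : Matrix ι ι ℂ)ᴴ
      = (U : Matrix ι ι ℂ) * A * 1 * B * (U : Matrix ι ι ℂ)ᴴ := by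
        simp only [Matrix.mul_assoc, Matrix.one_mul]
    _ = _ := by rw [← h]; simp only [Matrix.mul_assoc]

lemma conj_symm_mul_conj_of_unitary {ι : Type*} [Fintype ι] [DecidableEq ι]
    (U : Matrix.unitaryGroup ι ℂ) (A B : Matrix ι ι ℂ) :
    (U : Matrix ι ι ℂ)ᴴ * (A * B) * (U : Matrix ι ι ℂ) =
      ((U : Matrix ι ι ℂ)ᴴ * A * (U : Matrix ι ι ℂ)) *
        ((U : Matrix ι ι ℂ)ᴴ * B * (U : Matrix ι ι ℂ)) := by
  have h := mul_conjTranspose_self_of_unitary U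
  calc (U : Matrix ι ι ℂ)ᴴ * (A * B) * (U : Matrix ι ι ℂ)
      = (U : Matrix ι ι ℂ)ᴴ * A * 1 * B * (U : Matrix ι ι ℂ) := by
        simp only [Matrix.mul_assoc, Matrix.one_mul]
    _ = _ := by rw [← h]; simp only [Matrix.mul_assoc]

lemma HasModeUnitary.conj_creation (h : HasModeUnitary U u) (i : Fin L) :
    (U : FockOp L) * creation i * (U : FockOp L)ᴴ = ∑ j, star (u i j) • creation j := by
  have := congrArg Matrix.conjTranspose (h i)
  simpa [Matrix.conjTranspose_mul, Matrix.conjTranspose_sum, Matrix.conjTranspose_smul, creation,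
    Matrix.mul_assoc] using this

lemma HasModeUnitary.conj_twoPoint (h : HasModeUnitary U u) (i j : Fin L) :
    (U : FockOp L) * (creation i * annihilation j) * (U : FockOp L)ᴴ =
      ∑ k, ∑ l, (star (u i k) * u j l) • (creation k * annihilation l) := by
  rw [conj_mul_conj_of_unitary, h.conj_creation, h j, Finset.sum_mul]
  refine Finset.sum_congr rfl fun k _ => ?_
  rw [Finset.mul_sum]
  refine Finset.sum_congr rfl fun l _ => ?_
  rw [smul_mul_smul_comm]

lemma HasModeUnitary.conj_twoPoint_apply_diag (h : HasModeUnitary U u) (i j : Fin L)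
    (n : Finset (Fin L)) :
    ((U : FockOp L) * (creation i * annihilation j) * (U : FockOp L)ᴴ) n n =
      ∑ k, (if k ∈ n then star (u i k) * u j k else 0) := by
  rw [h.conj_twoPoint]
  simp only [Matrix.sum_apply, Matrix.smul_apply, creation_mul_annihilation_apply_diag, smul_eq_mul]
  refine Finset.sum_congr rfl fun k _ => ?_
  simp

/-- Orthonormality of the columns of `u` inverts the linear relation defining `HasModeUnitary`. -/
lemma HasModeUnitary.conj_symm_annihilation (h : HasModeUnitary U u)
    (hu : uᴴ * u = 1) (k : Fin L) :
    (U : FockOp L)ᴴ * annihilation k * (U : FockOp L) = ∑ i, star (u i k) • annihilation i := by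
  have hUU := conjTranspose_mul_self_of_unitary U
  have key : ∑ i, star (u i k) • ((U : FockOp L) * annihilation i * (U : FockOp L)ᴴ) =
      annihilation k := by
    simp_rw [h _, Finset.smul_sum, smul_smul]
    rw [Finset.sum_comm]
    simp_rw [← Finset.sum_smul]
    have : ∀ j, ∑ i, star (u i k) * u i j = (1 : Matrix (Fin L) (Fin L) ℂ) k j := by
      intro j
      rw [← hu, Matrix.mul_apply]
      rfl
    simp_rw [this, Matrix.one_apply, ite_smul, one_smul, zero_smul]
    simp
  rw [← key, Finset.mul_sum, Finset.sum_mul]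
  refine Finset.sum_congr rfl fun i _ => ?_
  rw [Matrix.mul_smul, Matrix.smul_mul]
  congr 1
  calc (U : FockOp L)ᴴ * ((U : FockOp L) * annihilation i * (U : FockOp L)ᴴ) * (U : FockOp L)
      = ((U : FockOp L)ᴴ * (U : FockOp L)) * annihilation i *
          ((U : FockOp L)ᴴ * (U : FockOp L)) := by simp only [Matrix.mul_assoc]
    _ = annihilation i := by rw [hUU, Matrix.one_mul, Matrix.mul_one]

lemma HasModeUnitary.conj_symm_number (h : HasModeUnitary U u)
    (hu : uᴴ * u = 1) (k : Fin L) :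
    (U : FockOp L)ᴴ * (creation k * annihilation k) * (U : FockOp L) =
      ∑ l, ∑ m, (u l k * star (u m k)) • (creation l * annihilation m) := by
  have hc : (U : FockOp L)ᴴ * creation k * (U : FockOp L) = ∑ i, u i k • creation i := by
    have := congrArg Matrix.conjTranspose (h.conj_symm_annihilation hu k)
    simpa [Matrix.conjTranspose_mul, Matrix.conjTranspose_sum, Matrix.conjTranspose_smul, creation,
      Matrix.mul_assoc] using this
  rw [conj_symm_mul_conj_of_unitary, hc, h.conj_symm_annihilation hu, Finset.sum_mul]
  refine Finset.sum_congr rfl fun l _ => ?_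
  rw [Finset.mul_sum]
  refine Finset.sum_congr rfl fun m _ => ?_
  rw [smul_mul_smul_comm]

lemma sum_fockProj (c : Finset (Fin L) → ℂ) :
    ∑ n, c n • (fockProj n : FockOp L) = Matrix.diagonal c := by
  ext a b
  simp only [Matrix.sum_apply, Matrix.smul_apply, fockProj, Matrix.single_apply, smul_eq_mul,
    Matrix.diagonal_apply, mul_ite, mul_one, mul_zero, ite_and]
  simp

/-- Pointwise form of the channel, before taking expectations. -/
lemma HasModeUnitary.sum_twoPoint_diag_smul (h : HasModeUnitary U u)
    (hu : uᴴ * u = 1) (i j : Fin L) :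
    ∑ n, ((U : FockOp L) * (creation i * annihilation j) * (U : FockOp L)ᴴ) n n •
        ((U : FockOp L)ᴴ * fockProj n * (U : FockOp L)) =
      ∑ l, ∑ m, (∑ k, star (u i k) * u j k * u l k * star (u m k)) •
        (creation l * annihilation m) := by
  calc _ = (U : FockOp L)ᴴ * (∑ n, ((U : FockOp L) * (creation i * annihilation j) *
          (U : FockOp L)ᴴ) n n • (fockProj n : FockOp L)) * (U : FockOp L) := by
        rw [Finset.mul_sum, Finset.sum_mul]
        simp only [Matrix.mul_smul, Matrix.smul_mul]
    -- The measurement dephases: the diagonal part is a combination of number operators.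
    _ = (U : FockOp L)ᴴ * (∑ k, (star (u i k) * u j k) • (creation k * annihilation k)) *
          (U : FockOp L) := by
        congr 2
        rw [sum_fockProj]
        ext a b
        simp only [Matrix.sum_apply, Matrix.smul_apply, creation_mul_annihilation_self,
          Matrix.diagonal_apply, smul_eq_mul, h.conj_twoPoint_apply_diag]
        split_ifs <;> simp
    _ = ∑ k, (star (u i k) * u j k) •
          ∑ l, ∑ m, (u l k * star (u m k)) • (creation l * annihilation m) := by
        rw [Finset.mul_sum, Finset.sum_mul]
        refine Finset.sum_congr rfl fun k _ => ?_
        rw [Matrix.mul_smul, Matrix.smul_mul, h.conj_symm_number hu]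
    _ = _ := by
        simp_rw [Finset.smul_sum, smul_smul, Finset.sum_smul]
        rw [Finset.sum_comm]
        refine Finset.sum_congr rfl fun l _ => ?_
        rw [Finset.sum_comm]
        simp only [mul_assoc]

end ModeUnitary

/-- Writes the projection as a product over sites of $n_k$ or $1-n_k$, whose conjugates by $U$
depend on `u` alone. -/
lemma fockProj_eq_diagonal_prod (n : Finset (Fin L)) :
    (fockProj n : FockOp L) = Matrix.diagonal (∏ k : Fin L, fun m : Finset (Fin L) =>
      if k ∈ n then (if k ∈ m then (1 : ℂ) else 0) else 1 - (if k ∈ m then (1 : ℂ) else 0)) := by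
  rw [fockProj, ← Matrix.diagonal_single]
  congr 1
  ext m
  rw [Finset.prod_apply, Pi.single_apply]
  by_cases hmn : m = n
  · subst hmn
    rw [if_pos rfl, Finset.prod_eq_one]
    intro k _
    split_ifs <;> simp
  · rw [if_neg hmn]
    obtain ⟨k, hk⟩ : ∃ k, ¬(k ∈ m ↔ k ∈ n) := by
      by_contra! hcon
      exact hmn (Finset.ext hcon)
    refine (Finset.prod_eq_zero (Finset.mem_univ k) ?_).symm
    by_cases h1 : k ∈ m <;> by_cases h2 : k ∈ n <;> simp_all

lemma conjTranspose_mul_self_of_CUSym (u : CUSym L) :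
    ((u : Matrix.unitaryGroup (Fin L) ℂ) : Matrix (Fin L) (Fin L) ℂ)ᴴ *
      ((u : Matrix.unitaryGroup (Fin L) ℂ) : Matrix (Fin L) (Fin L) ℂ) = 1 :=
  conjTranspose_mul_self_of_unitary _

lemma continuous_CUSym_apply (i j : Fin L) :
    Continuous fun u : CUSym L => (u : Matrix (Fin L) (Fin L) ℂ) i j :=
  (continuous_subtype_val.comp continuous_subtype_val).matrix_elem i j

/-! ### Integrability and the channel as a Haar moment. -/

section Channel

variable {Ω : Type*} {U : Ω → Matrix.unitaryGroup (Finset (Fin L)) ℂ} {u : Ω → CUSym L}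

/-- Although `U` is only determined by `u` up to a phase, the rotated Fock projections are
continuous functions of `u`. -/
lemma exists_continuous_conj_symm_fockProj
    (hU : ∀ ω, HasModeUnitary (U ω) (u ω : Matrix (Fin L) (Fin L) ℂ)) (n : Finset (Fin L)) :
    ∃ G : CUSym L → FockOp L, Continuous G ∧
      ∀ ω, (U ω : FockOp L)ᴴ * fockProj n * (U ω : FockOp L) = G (u ω) := by
  rw [fockProj_eq_diagonal_prod]
  -- Conjugation is multiplicative, so each site contributes a factor `N` or `1 - N`, polynomial in
  -- the entries of $u$ and their conjugates.
  induction (Finset.univ : Finset (Fin L)) using Finset.induction_on with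
  | empty =>
    refine ⟨fun _ => 1, continuous_const, fun ω => ?_⟩
    have : Matrix.diagonal (1 : Finset (Fin L) → ℂ) = 1 := Matrix.diagonal_one
    rw [Finset.prod_empty, this, Matrix.mul_one, conjTranspose_mul_self_of_unitary]
  | insert k s hk ih =>
    obtain ⟨G, hG, hGU⟩ := ih
    let N : CUSym L → FockOp L := fun v => ∑ l, ∑ m,
      ((v : Matrix (Fin L) (Fin L) ℂ) l k * star ((v : Matrix (Fin L) (Fin L) ℂ) m k)) •
        (creation l * annihilation m)
    have hN : Continuous N := by
      refine continuous_finsetSum _ fun l _ => continuous_finsetSum _ fun m _ => ?_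
      exact ((continuous_CUSym_apply l k).mul (continuous_CUSym_apply m k).star).smul
        continuous_const
    have hNU : ∀ ω, (U ω : FockOp L)ᴴ *
        (Matrix.diagonal fun m : Finset (Fin L) => if k ∈ m then (1 : ℂ) else 0) *
          (U ω : FockOp L) = N (u ω) := fun ω => by
      rw [← creation_mul_annihilation_self,
        (hU ω).conj_symm_number (conjTranspose_mul_self_of_CUSym (u ω))]
    by_cases hkn : k ∈ n
    · refine ⟨fun v => N v * G v, hN.mul hG, fun ω => ?_⟩
      change _ = N (u ω) * G (u ω)
      rw [Finset.prod_insert hk, ← hGU, ← hNU, ← conj_symm_mul_conj_of_unitary,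
        Matrix.diagonal_mul_diagonal]
      simp only [if_pos hkn]
      rfl
    · refine ⟨fun v => (1 - N v) * G v, (continuous_const.sub hN).mul hG, fun ω => ?_⟩
      have h1 : (1 : FockOp L) - N (u ω) = (U ω : FockOp L)ᴴ *
          (Matrix.diagonal fun m : Finset (Fin L) => 1 - if k ∈ m then (1 : ℂ) else 0) *
            (U ω : FockOp L) := by
        have : (Matrix.diagonal fun m : Finset (Fin L) => 1 - if k ∈ m then (1 : ℂ) else 0) =
            1 - Matrix.diagonal fun m : Finset (Fin L) => if k ∈ m then (1 : ℂ) else 0 := by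
          rw [← Matrix.diagonal_one, Matrix.diagonal_sub]
        rw [this, Matrix.mul_sub, Matrix.sub_mul, hNU, Matrix.mul_one,
          conjTranspose_mul_self_of_unitary]
      change _ = (1 - N (u ω)) * G (u ω)
      rw [Finset.prod_insert hk, ← hGU, h1, ← conj_symm_mul_conj_of_unitary,
        Matrix.diagonal_mul_diagonal]
      simp only [if_neg hkn]
      rfl

variable [MeasurableSpace Ω]

lemma integrable_of_continuous_CUSym {P : Measure Ω} [IsFiniteMeasure P] {f : CUSym L → ℂ}
    (hf : Continuous f) (hu : Measurable u) {C : ℝ} (hC : ∀ v, ‖f v‖ ≤ C) :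
    Integrable (fun ω => f (u ω)) P :=
  Integrable.of_bound (hf.measurable.comp hu).aestronglyMeasurable C
    (Filter.Eventually.of_forall fun _ => hC _)

lemma norm_CUSym_apply_le (v : CUSym L) (i j : Fin L) :
    ‖(v : Matrix (Fin L) (Fin L) ℂ) i j‖ ≤ 1 :=
  entry_norm_bound_of_unitary (v : Matrix.unitaryGroup (Fin L) ℂ).2 i j

/-- Measurability comes from that of `u`, since both factors are continuous functions of it;
boundedness comes from unitarity. -/
lemma integrable_twoPoint_term {P : Measure Ω} [IsFiniteMeasure P]
    (hU : ∀ ω, HasModeUnitary (U ω) (u ω : Matrix (Fin L) (Fin L) ℂ)) (hu : Measurable u)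
    (i j : Fin L) (n a b : Finset (Fin L)) :
    Integrable (fun ω => ((U ω : FockOp L) * (creation i * annihilation j) *
      (U ω : FockOp L)ᴴ) n n * ((U ω : FockOp L)ᴴ * fockProj n * (U ω : FockOp L)) a b) P := by
  obtain ⟨G, hG, hGU⟩ := exists_continuous_conj_symm_fockProj hU n
  have hmeas : Measurable fun v : CUSym L =>
      (∑ k, (if k ∈ n then star ((v : Matrix (Fin L) (Fin L) ℂ) i k) *
        (v : Matrix (Fin L) (Fin L) ℂ) j k else 0)) * G v a b := by
    refine Continuous.measurable (Continuous.mul ?_ (hG.matrix_elem a b))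
    refine continuous_finsetSum _ fun k _ => ?_
    split_ifs
    · exact (continuous_CUSym_apply i k).star.mul (continuous_CUSym_apply j k)
    · exact continuous_const
  refine Integrable.of_bound (C := L * 1) ?_ (Filter.Eventually.of_forall fun ω => ?_)
  · simp_rw [hGU, (hU _).conj_twoPoint_apply_diag]
    exact (hmeas.comp hu).aestronglyMeasurable
  · rw [norm_mul]
    refine mul_le_mul ?_ ?_ (norm_nonneg _) (Nat.cast_nonneg _)
    · rw [(hU ω).conj_twoPoint_apply_diag]
      refine (norm_sum_le _ _).trans ?_
      refine (Finset.sum_le_card_nsmul _ _ 1 fun k _ => ?_).trans (by simp)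
      split_ifs
      · rw [norm_mul, norm_star]
        exact mul_le_one₀ (norm_CUSym_apply_le _ _ _) (norm_nonneg _) (norm_CUSym_apply_le _ _ _)
      · simp
    · have : ((U ω : FockOp L)ᴴ * fockProj n * (U ω : FockOp L)) a b =
          star ((U ω : FockOp L) n a) * (U ω : FockOp L) n b := by
        rw [fockProj, Matrix.mul_assoc, Matrix.mul_apply, Finset.sum_eq_single n]
        · simp
        · intro c _ hc
          simp [hc]
        · simp
      rw [this, norm_mul, norm_star]
      exact mul_le_one₀ (entry_norm_bound_of_unitary (U ω).2 _ _) (norm_nonneg _)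
        (entry_norm_bound_of_unitary (U ω).2 _ _)

/-- The product of four entries of `u` that governs the channel on two-point operators. -/
def twoPointMoment (v : CUSym L) (i j l m : Fin L) : ℂ :=
  ∑ k, star ((v : Matrix (Fin L) (Fin L) ℂ) i k) * (v : Matrix (Fin L) (Fin L) ℂ) j k *
    (v : Matrix (Fin L) (Fin L) ℂ) l k * star ((v : Matrix (Fin L) (Fin L) ℂ) m k)

lemma continuous_twoPointMoment (i j l m : Fin L) :
    Continuous fun v : CUSym L => twoPointMoment v i j l m :=
  continuous_finsetSum _ fun k _ =>
    (((continuous_CUSym_apply i k).star.mul (continuous_CUSym_apply j k)).mul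
      (continuous_CUSym_apply l k)).mul (continuous_CUSym_apply m k).star

lemma norm_twoPointMoment_le (v : CUSym L) (i j l m : Fin L) :
    ‖twoPointMoment v i j l m‖ ≤ L := by
  refine (norm_sum_le _ _).trans ((Finset.sum_le_card_nsmul _ _ 1 fun k _ => ?_).trans (by simp))
  simp only [norm_mul, norm_star]
  have h := fun i => norm_CUSym_apply_le v i k
  exact mul_le_one₀ (mul_le_one₀ (mul_le_one₀ (h _) (norm_nonneg _) (h _)) (norm_nonneg _) (h _))
    (norm_nonneg _) (h _)

lemma measurementChannel_twoPoint {P : Measure Ω} [IsFiniteMeasure P]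
    (hU : ∀ ω, HasModeUnitary (U ω) (u ω : Matrix (Fin L) (Fin L) ℂ)) (hu : Measurable u)
    (i j : Fin L) :
    measurementChannel P U (creation i * annihilation j) =
      ∑ l, ∑ m, (∫ ω, twoPointMoment (u ω) i j l m ∂P) • (creation l * annihilation m) := by
  ext a b
  simp only [measurementChannel, Matrix.sum_apply, Matrix.of_apply, Matrix.smul_apply, smul_eq_mul]
  rw [← integral_finsetSum _ fun n _ => integrable_twoPoint_term hU hu i j n a b]
  have hpt : ∀ ω, ∑ n, ((U ω : FockOp L) * (creation i * annihilation j) *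
      (U ω : FockOp L)ᴴ) n n * ((U ω : FockOp L)ᴴ * fockProj n * (U ω : FockOp L)) a b =
      ∑ l, ∑ m, twoPointMoment (u ω) i j l m * (creation l * annihilation m) a b := fun ω => by
    have := congrFun (congrFun ((hU ω).sum_twoPoint_diag_smul
      (conjTranspose_mul_self_of_CUSym (u ω)) i j) a) b
    simp only [Matrix.sum_apply, Matrix.smul_apply, smul_eq_mul] at this
    exact this
  simp_rw [hpt]
  have hint : ∀ l m, Integrable (fun ω =>
      twoPointMoment (u ω) i j l m * (creation l * annihilation m) a b) P := fun l m =>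
    (integrable_of_continuous_CUSym (continuous_twoPointMoment i j l m) hu
      fun v => norm_twoPointMoment_le v i j l m).mul_const _
  rw [integral_finsetSum _ fun l _ => integrable_finsetSum _ fun m _ => hint l m]
  refine Finset.sum_congr rfl fun l _ => ?_
  rw [integral_finsetSum _ fun m _ => hint l m]
  refine Finset.sum_congr rfl fun m _ => ?_
  rw [integral_mul_const]

end Channel

end Fock

/-! ### Fourier diagonalization of symmetric circulant unitaries. -/

section Haar

open ZMod

variable {n : ℕ}

/-- The first column of a symmetric circulant unitary, as a function on `ZMod (n + 1)`. -/
def firstColumn (v : CUSym (n + 1)) (x : ZMod (n + 1)) : ℂ :=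
  (v : Matrix (Fin (n + 1)) (Fin (n + 1)) ℂ) x 0

/-- Translation by `y`. `ZMod (n + 1)` unfolds to `Fin (n + 1)`, so site indices serve as ring
elements, as the additive characters require. -/
lemma apply_eq_firstColumn (v : CUSym (n + 1)) (x y : ZMod (n + 1)) :
    (v : Matrix (Fin (n + 1)) (Fin (n + 1)) ℂ) x y = firstColumn v (x - y) := by
  have h := v.2.1 (x - y : ZMod (n + 1)) 0 y
  change _ = (v : Matrix (Fin (n + 1)) (Fin (n + 1)) ℂ) (x - y : ZMod (n + 1)) 0
  rw [← h]
  exact congrArg₂ (v : Matrix (Fin (n + 1)) (Fin (n + 1)) ℂ) (sub_add_cancel x y).symm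
    (zero_add y).symm

lemma firstColumn_neg (v : CUSym (n + 1)) (x : ZMod (n + 1)) :
    firstColumn v (-x) = firstColumn v x := by
  have h := apply_eq_firstColumn v 0 x
  rw [zero_sub] at h
  rw [← h]
  exact v.2.2 _ _

lemma firstColumn_one (x : ZMod (n + 1)) :
    firstColumn (1 : CUSym (n + 1)) x = if x = 0 then 1 else 0 :=
  Matrix.one_apply

lemma firstColumn_mul (v w : CUSym (n + 1)) (x : ZMod (n + 1)) :
    firstColumn (v * w) x = ∑ y, firstColumn v (x - y) * firstColumn w y := by
  simp only [← apply_eq_firstColumn]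
  exact Matrix.mul_apply

lemma firstColumn_inv (v : CUSym (n + 1)) (x : ZMod (n + 1)) :
    firstColumn v⁻¹ x = star (firstColumn v x) := by
  rw [← firstColumn_neg v, ← zero_sub, ← apply_eq_firstColumn]
  rfl

lemma continuous_firstColumn (x : ZMod (n + 1)) :
    Continuous fun v : CUSym (n + 1) => firstColumn v x :=
  (continuous_subtype_val.comp continuous_subtype_val).matrix_elem _ _

lemma sum_stdAddChar_mul {N : ℕ} [NeZero N] (x : ZMod N) :
    ∑ p, stdAddChar (p * x) = if x = 0 then (N : ℂ) else 0 := by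
  rw [AddChar.sum_mulShift x (isPrimitive_stdAddChar N), ZMod.card]
  split_ifs <;> simp

lemma star_stdAddChar {N : ℕ} [NeZero N] (x : ZMod N) :
    star (stdAddChar x : ℂ) = stdAddChar (-x) :=
  (AddChar.map_neg_eq_conj stdAddChar x).symm

/-- The eigenvalue of a symmetric circulant unitary on the plane wave of momentum `p`. -/
noncomputable def momentumEigenvalue (v : CUSym (n + 1)) (p : ZMod (n + 1)) : ℂ :=
  ∑ x, stdAddChar (p * x) * firstColumn v x

lemma continuous_momentumEigenvalue (p : ZMod (n + 1)) :
    Continuous fun v : CUSym (n + 1) => momentumEigenvalue v p :=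
  continuous_finsetSum _ fun x _ => continuous_const.mul (continuous_firstColumn x)

/-- This is where symmetry of the matrix enters the spectrum: it pairs the momenta $\pm p$. -/
lemma momentumEigenvalue_neg (v : CUSym (n + 1)) (p : ZMod (n + 1)) :
    momentumEigenvalue v (-p) = momentumEigenvalue v p := by
  unfold momentumEigenvalue
  rw [← Equiv.sum_comp (Equiv.neg _)]
  refine Finset.sum_congr rfl fun x _ => ?_
  rw [Equiv.neg_apply, neg_mul_neg, firstColumn_neg]

lemma momentumEigenvalue_one (p : ZMod (n + 1)) :
    momentumEigenvalue (1 : CUSym (n + 1)) p = 1 := by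
  simp [momentumEigenvalue, firstColumn_one]

lemma momentumEigenvalue_mul (v w : CUSym (n + 1)) (p : ZMod (n + 1)) :
    momentumEigenvalue (v * w) p = momentumEigenvalue v p * momentumEigenvalue w p := by
  unfold momentumEigenvalue
  simp_rw [firstColumn_mul, Finset.mul_sum]
  rw [Finset.sum_comm]
  refine Finset.sum_congr rfl fun y _ => ?_
  rw [Finset.sum_mul, ← Equiv.sum_comp (Equiv.addRight y)]
  refine Finset.sum_congr rfl fun x _ => ?_
  rw [Equiv.coe_addRight, add_sub_cancel_right, mul_add, AddChar.map_add_eq_mul]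
  ring

/-- Conjugation inverts `v` and reflects the momentum; evenness undoes the reflection. -/
lemma star_momentumEigenvalue (v : CUSym (n + 1)) (p : ZMod (n + 1)) :
    star (momentumEigenvalue v p) = momentumEigenvalue v⁻¹ p := by
  rw [← momentumEigenvalue_neg v⁻¹]
  simp only [momentumEigenvalue, star_sum, star_mul', star_stdAddChar, firstColumn_inv, neg_mul]

lemma star_momentumEigenvalue_mul_self (v : CUSym (n + 1)) (p : ZMod (n + 1)) :
    star (momentumEigenvalue v p) * momentumEigenvalue v p = 1 := by
  rw [star_momentumEigenvalue, ← momentumEigenvalue_mul, inv_mul_cancel, momentumEigenvalue_one]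

lemma norm_momentumEigenvalue (v : CUSym (n + 1)) (p : ZMod (n + 1)) :
    ‖momentumEigenvalue v p‖ = 1 := by
  have h := congrArg norm (star_momentumEigenvalue_mul_self v p)
  rw [norm_mul, norm_star, norm_one] at h
  nlinarith [norm_nonneg (momentumEigenvalue v p)]

/-- Fourier inversion. -/
lemma firstColumn_eq_sum (v : CUSym (n + 1)) (x : ZMod (n + 1)) :
    firstColumn v x =
      ((n + 1 : ℕ) : ℂ)⁻¹ * ∑ p, stdAddChar (-(p * x)) * momentumEigenvalue v p := by
  have hN : ((n + 1 : ℕ) : ℂ) ≠ 0 := Nat.cast_ne_zero.2 n.succ_ne_zero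
  rw [eq_inv_mul_iff_mul_eq₀ hN]
  unfold momentumEigenvalue
  simp_rw [Finset.mul_sum]
  rw [Finset.sum_comm]
  have : ∀ y, ∑ p, (stdAddChar (-(p * x)) : ℂ) * (stdAddChar (p * y) * firstColumn v y) =
      (if y - x = 0 then ((n + 1 : ℕ) : ℂ) else 0) * firstColumn v y := by
    intro y
    rw [← sum_stdAddChar_mul, Finset.sum_mul]
    refine Finset.sum_congr rfl fun p _ => ?_
    rw [← mul_assoc, ← AddChar.map_add_eq_mul]
    congr 2
    ring
  simp_rw [this, sub_eq_zero]
  simp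

/-- The circulant matrix with prescribed eigenvalues on plane waves. -/
noncomputable def planeWaveMatrix (g : ZMod (n + 1) → ℂ) : Matrix (ZMod (n + 1)) (ZMod (n + 1)) ℂ :=
  Matrix.of fun x y => ((n + 1 : ℕ) : ℂ)⁻¹ * ∑ p, stdAddChar (p * (x - y)) * g p

/-- Orthogonality of characters: summing over the intermediate site forces equal momenta. -/
lemma planeWaveMatrix_mul (g h : ZMod (n + 1) → ℂ) :
    planeWaveMatrix g * planeWaveMatrix h = planeWaveMatrix (g * h) := by
  have hN : ((n + 1 : ℕ) : ℂ) ≠ 0 := Nat.cast_ne_zero.2 n.succ_ne_zero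
  ext x z
  simp only [Matrix.mul_apply, planeWaveMatrix, Matrix.of_apply, Pi.mul_apply]
  have h1 : ∀ y, ((n + 1 : ℕ) : ℂ)⁻¹ * (∑ p, stdAddChar (p * (x - y)) * g p) *
      (((n + 1 : ℕ) : ℂ)⁻¹ * ∑ q, stdAddChar (q * (y - z)) * h q) =
      ((n + 1 : ℕ) : ℂ)⁻¹ * ((n + 1 : ℕ) : ℂ)⁻¹ * ∑ p, ∑ q,
        stdAddChar (y * (q - p)) * (stdAddChar (p * x - q * z) * g p * h q) := by
    intro y
    rw [mul_mul_mul_comm, Finset.sum_mul_sum]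
    congr 1
    refine Finset.sum_congr rfl fun p _ => Finset.sum_congr rfl fun q _ => ?_
    have : (stdAddChar (p * (x - y)) * stdAddChar (q * (y - z)) : ℂ) =
        stdAddChar (y * (q - p)) * stdAddChar (p * x - q * z) := by
      rw [← AddChar.map_add_eq_mul, ← AddChar.map_add_eq_mul]
      congr 1
      ring
    linear_combination g p * h q * this
  simp_rw [h1]
  rw [← Finset.mul_sum, Finset.sum_comm]
  simp_rw [Finset.sum_comm (s := Finset.univ) (t := Finset.univ)
    (f := fun y q => stdAddChar (y * (q - _)) * _), ← Finset.sum_mul, sum_stdAddChar_mul,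
    sub_eq_zero]
  simp only [ite_mul, zero_mul, Finset.sum_ite_eq', Finset.mem_univ, if_true]
  rw [← Finset.mul_sum, mul_assoc, inv_mul_cancel_left₀ hN]
  congr 1
  refine Finset.sum_congr rfl fun p _ => ?_
  rw [mul_sub]
  ring

lemma planeWaveMatrix_one : planeWaveMatrix (1 : ZMod (n + 1) → ℂ) = 1 := by
  have hN : ((n + 1 : ℕ) : ℂ) ≠ 0 := Nat.cast_ne_zero.2 n.succ_ne_zero
  ext x y
  simp only [planeWaveMatrix, Matrix.of_apply, Pi.one_apply, mul_one, sum_stdAddChar_mul,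
    sub_eq_zero, Matrix.one_apply]
  split_ifs
  · exact inv_mul_cancel₀ hN
  · exact mul_zero _

lemma planeWaveMatrix_conjTranspose (g : ZMod (n + 1) → ℂ) :
    (planeWaveMatrix g)ᴴ = planeWaveMatrix (star g) := by
  ext x y
  simp only [planeWaveMatrix, Matrix.conjTranspose_apply, Matrix.of_apply, star_mul', star_sum,
    star_stdAddChar, Pi.star_apply, star_inv₀, star_natCast]
  congr 1
  refine Finset.sum_congr rfl fun p _ => ?_
  congr 2
  ring

lemma planeWaveMatrix_symm {g : ZMod (n + 1) → ℂ} (hg : ∀ p, g (-p) = g p) (x y : ZMod (n + 1)) :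
    planeWaveMatrix g x y = planeWaveMatrix g y x := by
  simp only [planeWaveMatrix, Matrix.of_apply]
  congr 1
  rw [← Equiv.sum_comp (Equiv.neg _)]
  refine Finset.sum_congr rfl fun p _ => ?_
  rw [Equiv.neg_apply, hg]
  congr 2
  ring

lemma planeWaveMatrix_add_add (g : ZMod (n + 1) → ℂ) (x y z : ZMod (n + 1)) :
    planeWaveMatrix g (x + z) (y + z) = planeWaveMatrix g x y := by
  simp only [planeWaveMatrix, Matrix.of_apply, add_sub_add_right_eq_sub]

lemma sum_stdAddChar_mul_planeWaveMatrix (g : ZMod (n + 1) → ℂ) (p : ZMod (n + 1)) :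
    ∑ x, stdAddChar (-p * x) * planeWaveMatrix g x 0 = g p := by
  have hN : ((n + 1 : ℕ) : ℂ) ≠ 0 := Nat.cast_ne_zero.2 n.succ_ne_zero
  simp only [planeWaveMatrix, Matrix.of_apply, sub_zero, Finset.mul_sum]
  rw [Finset.sum_comm]
  have : ∀ q : ZMod (n + 1), ∑ x, (stdAddChar (-p * x) : ℂ) *
      (((n + 1 : ℕ) : ℂ)⁻¹ * (stdAddChar (q * x) * g q)) =
      ((n + 1 : ℕ) : ℂ)⁻¹ * ((if q - p = 0 then ((n + 1 : ℕ) : ℂ) else 0) * g q) := by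
    intro q
    rw [← sum_stdAddChar_mul, Finset.sum_mul, Finset.mul_sum]
    refine Finset.sum_congr rfl fun x _ => ?_
    have h2 : (stdAddChar (x * (q - p)) : ℂ) = stdAddChar (-p * x) * stdAddChar (q * x) := by
      rw [← AddChar.map_add_eq_mul]
      congr 1
      ring
    rw [h2]
    ring
  simp_rw [this, sub_eq_zero]
  simp only [ite_mul, zero_mul, mul_ite, mul_zero, Finset.sum_ite_eq', Finset.mem_univ, if_true]
  exact inv_mul_cancel_left₀ hN _

/-- Every even phase function is the spectrum of a symmetric circulant unitary. -/
lemma exists_momentumEigenvalue_eq {g : ZMod (n + 1) → ℂ} (hg : ∀ p, g (-p) = g p)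
    (hg1 : ∀ p, star (g p) * g p = 1) :
    ∃ v : CUSym (n + 1), ∀ p, momentumEigenvalue v p = g p := by
  have hmem : planeWaveMatrix g ∈ Matrix.unitaryGroup (Fin (n + 1)) ℂ := by
    refine Matrix.mem_unitaryGroup_iff'.2 ?_
    have h : (planeWaveMatrix g)ᴴ * planeWaveMatrix g = 1 := by
      rw [planeWaveMatrix_conjTranspose, planeWaveMatrix_mul, ← planeWaveMatrix_one]
      congr 1
      exact funext hg1
    exact h
  refine ⟨⟨⟨planeWaveMatrix g, hmem⟩, fun i j k => ?_, planeWaveMatrix_symm hg⟩, fun p => ?_⟩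
  · exact planeWaveMatrix_add_add g i j k
  -- `planeWaveMatrix` and `momentumEigenvalue` use the same sign in the exponent, so the transform
  -- recovers `g` at the reflected momentum; evenness reconciles them.
  · rw [← momentumEigenvalue_neg]
    exact sum_stdAddChar_mul_planeWaveMatrix g p

lemma add_self_eq_zero_of_odd (hn : Odd (n + 1)) {x : ZMod (n + 1)} (h : x + x = 0) : x = 0 := by
  have h2 : IsUnit ((2 : ℕ) : ZMod (n + 1)) :=
    (ZMod.isUnit_iff_coprime 2 (n + 1)).2 (Nat.coprime_two_left.2 hn)
  refine (h2.mul_right_eq_zero).1 ?_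
  rw [← h]
  push_cast
  ring

/-! ### Haar averages of products of eigenvalues. -/

section Moments

variable (μ : Measure (CUSym (n + 1))) [μ.IsMulLeftInvariant]

/-- Left invariance makes the integral equal to `c` times itself. -/
lemma integral_eq_zero_of_mul_left {ψ : CUSym (n + 1) → ℂ} {c : ℂ} (v : CUSym (n + 1))
    (hψ : ∀ w, ψ (v * w) = c * ψ w) (hc : c ≠ 1) : ∫ w, ψ w ∂μ = 0 := by
  have h := integral_mul_left_eq_self (μ := μ) ψ v
  simp_rw [hψ] at h
  rw [integral_const_mul] at h
  have : (c - 1) * ∫ w, ψ w ∂μ = 0 := by linear_combination h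
  exact (mul_eq_zero.1 this).resolve_left (sub_ne_zero.2 hc)

/-- The phase function that is `i` at the momenta `± a` and `1` elsewhere. -/
lemma exists_momentumEigenvalue_eq_I (a : ZMod (n + 1)) :
    ∃ v : CUSym (n + 1), ∀ p,
      momentumEigenvalue v p = if p = a ∨ p = -a then Complex.I else 1 := by
  refine exists_momentumEigenvalue_eq (fun p => ?_) fun p => ?_
  · simp only [neg_eq_iff_eq_neg, neg_neg, or_comm]
  · split_ifs <;> simp

/-- The product of four eigenvalues whose Haar averages determine the two-point channel. -/
noncomputable def eigenvalueProduct (p q r s : ZMod (n + 1)) (v : CUSym (n + 1)) : ℂ :=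
  star (momentumEigenvalue v p) * momentumEigenvalue v q * momentumEigenvalue v r *
    star (momentumEigenvalue v s)

/-- The product is a character, so one group element where it differs from $1$ kills its average. -/
lemma eigenvalueProduct_mul (p q r s : ZMod (n + 1)) (v w : CUSym (n + 1)) :
    eigenvalueProduct p q r s (v * w) =
      eigenvalueProduct p q r s v * eigenvalueProduct p q r s w := by
  simp only [eigenvalueProduct, momentumEigenvalue_mul, star_mul']
  ring

lemma eigenvalueProduct_swap (p q r s : ZMod (n + 1)) :
    eigenvalueProduct p q r s = eigenvalueProduct s q r p := by
  ext v
  simp only [eigenvalueProduct]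
  ring

lemma eigenvalueProduct_eq_one {p q r s : ZMod (n + 1)} (hq : q = p ∨ q = -p)
    (hr : r = s ∨ r = -s) (v : CUSym (n + 1)) : eigenvalueProduct p q r s v = 1 := by
  have h1 : momentumEigenvalue v q = momentumEigenvalue v p := by
    rcases hq with rfl | rfl
    · rfl
    · exact momentumEigenvalue_neg v p
  have h2 : momentumEigenvalue v r = momentumEigenvalue v s := by
    rcases hr with rfl | rfl
    · rfl
    · exact momentumEigenvalue_neg v s
  rw [eigenvalueProduct, h1, h2, star_momentumEigenvalue_mul_self, one_mul, mul_comm,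
    star_momentumEigenvalue_mul_self]

lemma integral_eigenvalueProduct_eq_zero {p q r s : ZMod (n + 1)}
    (hp : ¬(q = p ∨ q = -p)) (hs : ¬(q = s ∨ q = -s)) :
    ∫ v, eigenvalueProduct p q r s v ∂μ = 0 := by
  obtain ⟨v, hv⟩ := exists_momentumEigenvalue_eq_I q
  refine integral_eq_zero_of_mul_left μ v (fun w => eigenvalueProduct_mul p q r s v w) ?_
  have hp' : ¬(p = q ∨ p = -q) := by rwa [eq_comm, eq_comm (a := p), neg_eq_iff_eq_neg]
  have hs' : ¬(s = q ∨ s = -q) := by rwa [eq_comm, eq_comm (a := s), neg_eq_iff_eq_neg]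
  simp only [eigenvalueProduct, hv, if_neg hp', if_neg hs', true_or, if_true]
  -- At the test element the product is $i^2$ if $r=\pm q$ and $i$ otherwise. The phase $-1$ would
  -- fail in the first case.
  split_ifs
  · norm_num
  · intro h
    simpa using congrArg Complex.re h

lemma integral_eigenvalueProduct_eq_zero_of_left {p q r s : ZMod (n + 1)}
    (hq : q = p ∨ q = -p) (hr : ¬(r = s ∨ r = -s)) :
    ∫ v, eigenvalueProduct p q r s v ∂μ = 0 := by
  obtain ⟨v, hv⟩ := exists_momentumEigenvalue_eq_I r
  refine integral_eq_zero_of_mul_left μ v (fun w => eigenvalueProduct_mul p q r s v w) ?_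
  have hs' : ¬(s = r ∨ s = -r) := by rwa [eq_comm, eq_comm (a := s), neg_eq_iff_eq_neg]
  have h1 : momentumEigenvalue v q = momentumEigenvalue v p := by
    rcases hq with rfl | rfl
    · rfl
    · exact momentumEigenvalue_neg v p
  rw [eigenvalueProduct, h1, star_momentumEigenvalue_mul_self, hv, hv, if_neg hs']
  simp only [true_or, if_true]
  intro h
  simpa using congrArg Complex.re h

variable [IsProbabilityMeasure μ]

/-- Conservation turns sign coincidences into true pairings: $q=-p,\ r=s$ gives $2p=0$, and $q=-p,\
r=-s$ gives $2(p+s)=0$. Oddness removes the factor $2$. -/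
lemma integral_eigenvalueProduct_of_left (hn : Odd (n + 1)) {p q r s : ZMod (n + 1)}
    (h : p + s = q + r) (hq : q = p ∨ q = -p) :
    ∫ v, eigenvalueProduct p q r s v ∂μ = if (q = p ∧ r = s) ∨ (q = s ∧ r = p) then 1 else 0 := by
  by_cases hr : r = s ∨ r = -s
  · simp_rw [eigenvalueProduct_eq_one hq hr]
    rw [if_pos, integral_const, probReal_univ, one_smul]
    rcases hq with rfl | rfl
    · exact Or.inl ⟨rfl, (add_left_cancel h).symm⟩
    · rcases hr with rfl | rfl
      · left
        have : p = 0 := add_self_eq_zero_of_odd hn (by linear_combination h)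
        simp [this]
      · right
        have : p + s = 0 := add_self_eq_zero_of_odd hn (by linear_combination h)
        exact ⟨by linear_combination -this, by linear_combination -this⟩
  · rw [integral_eigenvalueProduct_eq_zero_of_left μ hq hr, if_neg]
    rintro (⟨_, h2⟩ | ⟨h1, h2⟩)
    · exact hr (Or.inl h2)
    · refine hr ?_
      rw [h1] at hq
      rw [h2]
      rcases hq with rfl | rfl
      · exact Or.inl rfl
      · exact Or.inr (neg_neg p).symm

lemma integral_eigenvalueProduct (hn : Odd (n + 1)) {p q r s : ZMod (n + 1)}
    (h : p + s = q + r) :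
    ∫ v, eigenvalueProduct p q r s v ∂μ = if (q = p ∧ r = s) ∨ (q = s ∧ r = p) then 1 else 0 := by
  by_cases hp : q = p ∨ q = -p
  · exact integral_eigenvalueProduct_of_left μ hn h hp
  by_cases hs : q = s ∨ q = -s
  · rw [eigenvalueProduct_swap,
      integral_eigenvalueProduct_of_left μ hn ((add_comm s p).trans h) hs]
    simp only [or_comm]
  · rw [integral_eigenvalueProduct_eq_zero μ hp hs, if_neg]
    rintro (⟨h1, _⟩ | ⟨h1, _⟩)
    · exact hp (Or.inl h1)
    · exact hs (Or.inl h1)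

end Moments

end Haar

/-! ### Evaluation of the fourth moment. -/

section TwoPoint

open ZMod

variable {n : ℕ}

/-- Four Fourier inversions give $N^{-4}$ with $N=n+1$; the sum over the common site `k` gives $N$
times the conservation constraint. -/
lemma twoPointMoment_eq_sum (v : CUSym (n + 1)) (i j l m : ZMod (n + 1)) :
    twoPointMoment v i j l m = (((n + 1 : ℕ) : ℂ)⁻¹) ^ 3 * ∑ p, ∑ q, ∑ r, ∑ s,
      (if q + r = p + s then
        stdAddChar (p * i - q * j - r * l + s * m) * eigenvalueProduct p q r s v else 0) := by
  have hN : ((n + 1 : ℕ) : ℂ) ≠ 0 := Nat.cast_ne_zero.2 n.succ_ne_zero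
  have hstar : ∀ x, star (firstColumn v x) = ((n + 1 : ℕ) : ℂ)⁻¹ *
      ∑ p, stdAddChar (p * x) * star (momentumEigenvalue v p) := by
    intro x
    rw [firstColumn_eq_sum]
    simp only [star_mul', star_sum, star_stdAddChar, star_inv₀, star_natCast, neg_neg]
  have hterm : ∀ k : ZMod (n + 1), star (firstColumn v (i - k)) * firstColumn v (j - k) *
      firstColumn v (l - k) * star (firstColumn v (m - k)) =
      (((n + 1 : ℕ) : ℂ)⁻¹) ^ 4 * ∑ p, ∑ q, ∑ r, ∑ s, stdAddChar (k * (q + r - (p + s))) *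
        (stdAddChar (p * i - q * j - r * l + s * m) * eigenvalueProduct p q r s v) := by
    intro k
    rw [hstar, hstar, firstColumn_eq_sum v (j - k), firstColumn_eq_sum v (l - k)]
    have hmul : ∀ c A B C D : ℂ, c * A * (c * B) * (c * C) * (c * D) =
        c ^ 4 * (A * (B * (C * D))) := fun _ _ _ _ _ => by ring
    rw [hmul]
    congr 1
    rw [Finset.sum_mul]
    refine Finset.sum_congr rfl fun p _ => ?_
    rw [Finset.sum_mul, Finset.mul_sum]
    refine Finset.sum_congr rfl fun q _ => ?_
    rw [Finset.sum_mul, Finset.mul_sum, Finset.mul_sum]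
    refine Finset.sum_congr rfl fun r _ => ?_
    rw [Finset.mul_sum, Finset.mul_sum, Finset.mul_sum]
    refine Finset.sum_congr rfl fun s _ => ?_
    have hχ : (stdAddChar (k * (q + r - (p + s))) *
        stdAddChar (p * i - q * j - r * l + s * m) : ℂ) =
        stdAddChar (p * (i - k)) * stdAddChar (-(q * (j - k))) *
          stdAddChar (-(r * (l - k))) * stdAddChar (s * (m - k)) := by
      simp only [← AddChar.map_add_eq_mul]
      congr 1
      ring
    rw [← mul_assoc (stdAddChar (k * _)), hχ, eigenvalueProduct]
    ring
  have hsum : twoPointMoment v i j l m = ∑ k : ZMod (n + 1), star (firstColumn v (i - k)) *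
      firstColumn v (j - k) * firstColumn v (l - k) * star (firstColumn v (m - k)) := by
    simp only [← apply_eq_firstColumn]
    rfl
  rw [hsum]
  simp_rw [hterm]
  rw [← Finset.mul_sum, pow_succ, mul_assoc]
  congr 1
  rw [inv_mul_eq_iff_eq_mul₀ hN, Finset.mul_sum, Finset.sum_comm]
  refine Finset.sum_congr rfl fun p _ => ?_
  rw [Finset.mul_sum, Finset.sum_comm]
  refine Finset.sum_congr rfl fun q _ => ?_
  rw [Finset.mul_sum, Finset.sum_comm]
  refine Finset.sum_congr rfl fun r _ => ?_
  rw [Finset.mul_sum, Finset.sum_comm]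
  refine Finset.sum_congr rfl fun s _ => ?_
  rw [← Finset.sum_mul, sum_stdAddChar_mul]
  simp only [sub_eq_zero]
  split_ifs <;> simp

lemma integrable_eigenvalueProduct (μ : Measure (CUSym (n + 1))) [IsFiniteMeasure μ]
    (p q r s : ZMod (n + 1)) : Integrable (eigenvalueProduct p q r s) μ := by
  have hc : Continuous (eigenvalueProduct p q r s) :=
    (((continuous_momentumEigenvalue p).star.mul (continuous_momentumEigenvalue q)).mul
      (continuous_momentumEigenvalue r)).mul (continuous_momentumEigenvalue s).star
  refine Integrable.of_bound hc.measurable.aestronglyMeasurable 1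
    (Filter.Eventually.of_forall fun v => ?_)
  simp [eigenvalueProduct, norm_momentumEigenvalue]

lemma integral_twoPointMoment (hn : Odd (n + 1)) (μ : Measure (CUSym (n + 1)))
    [μ.IsMulLeftInvariant] [IsProbabilityMeasure μ] (i j l m : ZMod (n + 1)) :
    ∫ v, twoPointMoment v i j l m ∂μ =
      1 / ((n + 1 : ℕ) : ℂ) * ((if i = j then 1 else 0) * (if l = m then 1 else 0) +
          (if i = l then 1 else 0) * (if j = m then 1 else 0) -
          1 / ((n + 1 : ℕ) : ℂ) * (if i - j = l - m then 1 else 0)) := by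
  have hN : ((n + 1 : ℕ) : ℂ) ≠ 0 := Nat.cast_ne_zero.2 n.succ_ne_zero
  simp_rw [twoPointMoment_eq_sum]
  have hint : ∀ p q r s : ZMod (n + 1), Integrable (fun v => if q + r = p + s then
      stdAddChar (p * i - q * j - r * l + s * m) * eigenvalueProduct p q r s v else 0) μ := by
    intro p q r s
    split_ifs
    · exact (integrable_eigenvalueProduct μ p q r s).const_mul _
    · exact integrable_zero _ _ _
  -- Inclusion–exclusion over the two pairings, which hold together exactly when all four momenta
  -- agree. Each pairing implies conservation, so the constraint disappears.
  have hval : ∀ p q r s : ZMod (n + 1), ∫ v, (if q + r = p + s then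
      stdAddChar (p * i - q * j - r * l + s * m) * eigenvalueProduct p q r s v else 0) ∂μ =
      (if q = p then if r = s then (stdAddChar (p * (i - j)) * stdAddChar (s * (m - l)) : ℂ)
        else 0 else 0) +
      (if q = s then if r = p then (stdAddChar (p * (i - l)) * stdAddChar (s * (m - j)) : ℂ)
        else 0 else 0) -
      (if q = p then if r = p then if s = p then (stdAddChar (p * (i - j - (l - m))) : ℂ)
        else 0 else 0 else 0) := by
    intro p q r s
    have h1 : q = p → r = s → (stdAddChar (p * i - q * j - r * l + s * m) : ℂ) =
        stdAddChar (p * (i - j)) * stdAddChar (s * (m - l)) := by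
      rintro rfl rfl
      rw [← AddChar.map_add_eq_mul]
      congr 1
      ring
    have h2 : q = s → r = p → (stdAddChar (p * i - q * j - r * l + s * m) : ℂ) =
        stdAddChar (p * (i - l)) * stdAddChar (s * (m - j)) := by
      rintro rfl rfl
      rw [← AddChar.map_add_eq_mul]
      congr 1
      ring
    have h3 : q = p → r = p → s = p → (stdAddChar (p * i - q * j - r * l + s * m) : ℂ) =
        stdAddChar (p * (i - j - (l - m))) := by
      rintro rfl rfl rfl
      congr 1
      ring
    by_cases h : q + r = p + s
    · simp only [if_pos h]
      rw [integral_const_mul, integral_eigenvalueProduct μ hn h.symm]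
      by_cases hA : q = p ∧ r = s
      · by_cases hB : q = s ∧ r = p
        · have hs : s = p := hB.1.symm.trans hA.1
          rw [if_pos (Or.inl hA), if_pos hA.1, if_pos hA.2, if_pos hB.1, if_pos hB.2, if_pos hA.1,
            if_pos hB.2, if_pos hs, ← h1 hA.1 hA.2, ← h2 hB.1 hB.2, ← h3 hA.1 hB.2 hs]
          ring
        · have hC : ¬(r = p) := fun hr => hB ⟨by rw [hA.1, ← hr, hA.2], hr⟩
          rw [if_pos (Or.inl hA), if_pos hA.1, if_pos hA.2, h1 hA.1 hA.2]
          simp [hC]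
      · by_cases hB : q = s ∧ r = p
        · have hC : ¬(q = p) := fun hq => hA ⟨hq, by rw [hB.2, ← hq, hB.1]⟩
          rw [if_pos (Or.inr hB), if_neg hC, if_neg hC, if_pos hB.1, if_pos hB.2, h2 hB.1 hB.2]
          ring
        · rw [if_neg (not_or.2 ⟨hA, hB⟩)]
          simp only [← ite_and]
          rw [if_neg hA, if_neg hB, if_neg]
          · ring
          · rintro ⟨a, b, c⟩
            exact hA ⟨a, b.trans c.symm⟩
    · simp only [if_neg h, integral_zero, ← ite_and]
      rw [if_neg, if_neg, if_neg]
      · ring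
      · rintro ⟨rfl, rfl, rfl⟩
        exact h rfl
      · rintro ⟨rfl, rfl⟩
        exact h (add_comm _ _)
      · rintro ⟨rfl, rfl⟩
        exact h rfl
  rw [integral_const_mul]
  -- Each pairing leaves two free momenta, hence $N^2$; the overlap leaves one, hence a single $N$.
  have hI : ∫ v, ∑ p, ∑ q, ∑ r, ∑ s, (if q + r = p + s then
      stdAddChar (p * i - q * j - r * l + s * m) * eigenvalueProduct p q r s v else 0) ∂μ =
      ((n + 1 : ℕ) : ℂ) * (if i = j then 1 else 0) *
          (((n + 1 : ℕ) : ℂ) * (if l = m then 1 else 0)) +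
        ((n + 1 : ℕ) : ℂ) * (if i = l then 1 else 0) *
          (((n + 1 : ℕ) : ℂ) * (if j = m then 1 else 0)) -
        ((n + 1 : ℕ) : ℂ) * (if i - j = l - m then 1 else 0) := by
    rw [integral_finsetSum _ fun p _ => integrable_finsetSum _ fun q _ =>
      integrable_finsetSum _ fun r _ => integrable_finsetSum _ fun s _ => hint p q r s]
    simp_rw [integral_finsetSum _ fun q _ =>
      integrable_finsetSum _ fun r _ => integrable_finsetSum _ fun s _ => hint _ q r s,
      integral_finsetSum _ fun r _ => integrable_finsetSum _ fun s _ => hint _ _ r s,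
      integral_finsetSum _ fun s _ => hint _ _ _ s, hval]
    have hδ : ∀ x : ZMod (n + 1), ∑ p, (stdAddChar (p * x) : ℂ) =
        ((n + 1 : ℕ) : ℂ) * if x = 0 then 1 else 0 := by
      intro x
      rw [sum_stdAddChar_mul, mul_ite, mul_one, mul_zero]
    have e1 : (if i = j then (1 : ℂ) else 0) = if i - j = 0 then 1 else 0 := by
      simp only [sub_eq_zero]
    have e2 : (if l = m then (1 : ℂ) else 0) = if m - l = 0 then 1 else 0 := by
      simp only [sub_eq_zero, eq_comm]
    have e3 : (if i = l then (1 : ℂ) else 0) = if i - l = 0 then 1 else 0 := by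
      simp only [sub_eq_zero]
    have e4 : (if j = m then (1 : ℂ) else 0) = if m - j = 0 then 1 else 0 := by
      simp only [sub_eq_zero, eq_comm]
    have e5 : (if i - j = l - m then (1 : ℂ) else 0) = if i - j - (l - m) = 0 then 1 else 0 := by
      simp only [sub_eq_zero]
    rw [e1, e2, e3, e4, e5, ← hδ, ← hδ, ← hδ, ← hδ, ← hδ, Finset.sum_mul_sum, Finset.sum_mul_sum,
      ← Finset.sum_add_distrib, ← Finset.sum_sub_distrib]
    refine Finset.sum_congr rfl fun p _ => ?_
    simp only [Finset.sum_add_distrib, Finset.sum_sub_distrib]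
    congr 1
    · congr 1
      · rw [Finset.sum_eq_single p (fun q _ hq => by simp [hq]) (by simp)]
        simp
      · rw [Finset.sum_comm, Finset.sum_eq_single p (fun r _ hr => by simp [hr]) (by simp),
          Finset.sum_comm]
        simp
    · rw [Finset.sum_eq_single p (fun q _ hq => by simp [hq]) (by simp)]
      simp
  rw [hI]
  field_simp

end TwoPoint

theorem mainTheorem1 (L : ℕ) (hL : Odd L)
    {Ω : Type*} [MeasurableSpace Ω] (P : Measure Ω) [IsProbabilityMeasure P]
    (U : Ω → Matrix.unitaryGroup (Finset (Fin L)) ℂ) (u : Ω → CUSym L)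
    (hU : ∀ ω, HasModeUnitary (U ω) (u ω : Matrix (Fin L) (Fin L) ℂ))
    (hu : Measurable u) (hHaar : (P.map u).IsHaarMeasure)
    (M : Fin L → Fin L → Fin L → Fin L → ℂ) :
    IsTwoPointBlock P U M ↔
      ∀ i j l m : Fin L, M i j l m =
        1 / (L : ℂ) * ((if i = j then 1 else 0) * (if l = m then 1 else 0) +
          (if i = l then 1 else 0) * (if j = m then 1 else 0) -
          1 / (L : ℂ) * (if i - j = l - m then 1 else 0)) := by
  obtain _ | n := L
  · exact absurd hL (by decide)
  -- `IsHaarMeasure` fixes the law only up to scale; this supplies the normalization.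
  have : IsProbabilityMeasure (P.map u) := Measure.isProbabilityMeasure_map hu.aemeasurable
  have hmoment : ∀ i j l m : Fin (n + 1), ∫ ω, twoPointMoment (u ω) i j l m ∂P =
      1 / ((n + 1 : ℕ) : ℂ) * ((if i = j then 1 else 0) * (if l = m then 1 else 0) +
        (if i = l then 1 else 0) * (if j = m then 1 else 0) -
        1 / ((n + 1 : ℕ) : ℂ) * (if i - j = l - m then 1 else 0)) := by
    intro i j l m
    rw [← integral_map hu.aemeasurable
      (continuous_twoPointMoment i j l m).measurable.aestronglyMeasurable]
    exact integral_twoPointMoment hL (P.map u) i j l m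
  simp_rw [← hmoment]
  unfold IsTwoPointBlock
  simp_rw [measurementChannel_twoPoint hU hu]
  refine ⟨fun h i j l m => (twoPoint_coeff_ext (h i j) l m).symm, fun h i j => ?_⟩
  simp_rw [h]
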